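/- Let $A=(a_{pq})_{p,q\in P}$ be a generalized Cartan matrix indexed by a finite set $P$ (integer entries, $a_{pp}=2$, $a_{pq}\le 0$ for $p\ne q$, and $a_{pq}=0\Leftrightarrow a_{qp}=0$), and let $\Gamma$ be its Dynkin diagram; distinct $p,q\in P$ are adjacent in $\Gamma$ when $a_{pq}\neq 0$. Write $p\,\mathcal C\,q$ if $p=q$ or $p,q$ are adjacent. A *labelled heap* over $\Gamma$ is a locally finite poset $(E,\le)$ with a map $\varepsilon:E\to P$ such that (1) $\alpha,\beta\in E$ are comparable whenever $\varepsilon(\alpha)\,\mathcal C\,\varepsilon(\beta)$, and (2) $\le$ is the transitive closure of the relation "$\alpha\le\beta$ and $\varepsilon(\alpha)\,\mathcal C\,\varepsilon(\beta)$". It is *fibred* if (a) for each $p\in P$ the set $\varepsilon^{-1}(p)$ is nonempty and is unbounded above and below, and (b) for all adjacent $p,p'\in P$ and every $\alpha\in\varepsilon^{-1}(p)$ there is $\beta\in\varepsilon^{-1}(p')$ such that $\alpha$ covers $\beta$ or $\beta$ covers $\alpha$. A fibred heap is *full* if $\sum_{\gamma\in(\alpha,\beta)}a_{p,\varepsilon(\gamma)}=-2$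 for every open interval $(\alpha,\beta)$ of $E$ with $\alpha<\beta$, $\varepsilon(\alpha)=\varepsilon(\beta)=p$ and $(\alpha,\beta)\cap\varepsilon^{-1}(p)=\emptyset$. The matrix $A$ is of *finite type* if $\Gamma$ is connected (and nonempty), $\det A\ne0$, there is a real vector $u>0$ with $Au>0$, and for every real vector $v$, $Av\ge0$ implies $v>0$ or $v=0$ (here $u>0$ and $v \geq 0$ are meant entrywise). **Corollary 8.8.** If $A$ is of finite type, or is, up to relabelling of $P$, of affine type $F_4^{(1)}$, $E_8^{(1)}$ or $E_6^{(2)}$ (in Kac's notation), then there is no full heap over $\Gamma$. -/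

import Mathlib

/-- A generalized Cartan matrix: an integer square matrix with diagonal entries `2`, off-diagonal
entries `≤ 0`, and a zero pattern that is symmetric. -/
structure IsGCM {P : Type*} (A : Matrix P P ℤ) : Prop where
  diag : ∀ p, A p p = 2
  nonpos : ∀ p q, p ≠ q → A p q ≤ 0
  zero_iff : ∀ p q, A p q = 0 ↔ A q p = 0

/-- The underlying simple graph of the Dynkin diagram of `A`: distinct vertices `p`, `q` are
adjacent if they are joined by at least one line. The multiplicities and the arrows of the
diagram are recorded by the matrix `A` itself, which the diagram determines. -/
def dynkinGraph {P : Type*} (A : Matrix P P ℤ) : SimpleGraph P where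
  Adj p q := p ≠ q ∧ (A p q ≠ 0 ∨ A q p ≠ 0)
  symm := ⟨fun _ _ h => ⟨h.1.symm, h.2.symm⟩⟩
  loopless := ⟨fun _ h => h.1 rfl⟩

/-- `A` is a generalized Cartan matrix of finite type: it is indecomposable (its Dynkin diagram is
connected, in particular nonempty), `det A ≠ 0`, there is a real vector `u > 0` with `A u > 0`,
and `A v ≥ 0` implies `v > 0` or `v = 0`. Here `u > 0` means that all entries are positive. -/
structure IsFiniteTypeGCM {P : Type*} [Fintype P] [DecidableEq P] (A : Matrix P P ℤ) : Prop where
  isGCM : IsGCM A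
  connected : (dynkinGraph A).Connected
  det_ne_zero : A.det ≠ 0
  exists_pos : ∃ u : P → ℝ, (∀ p, 0 < u p) ∧ ∀ p, 0 < (A.map (Int.cast : ℤ → ℝ)).mulVec u p
  pos_or_zero : ∀ v : P → ℝ, (∀ p, 0 ≤ (A.map (Int.cast : ℤ → ℝ)).mulVec v p) →
    (∀ p, 0 < v p) ∨ v = 0

/-- `A` is the matrix `B` up to a relabelling of the rows and columns, that is, the Dynkin
diagrams of `A` and `B` have the same type. -/
def SameType {P Q : Type*} (A : Matrix P P ℤ) (B : Matrix Q Q ℤ) : Prop :=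
  ∃ e : P ≃ Q, ∀ p q, A p q = B (e p) (e q)

/-- The affine matrix of type `F₄⁽¹⁾`. The diagram is the chain `0 — 1 — 2 ⇒ 3 — 4`, with
the arrow pointing towards `3`. -/
def affineF4 : Matrix (Fin 5) (Fin 5) ℤ :=
  !![ 2, -1,  0,  0,  0;
     -1,  2, -1,  0,  0;
      0, -1,  2, -1,  0;
      0,  0, -2,  2, -1;
      0,  0,  0, -1,  2]

/-- The twisted affine matrix of type `E₆⁽²⁾`. The diagram is the chain `0 — 1 — 2 ⇐ 3 — 4`,
with the arrow pointing towards `2`. -/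
def twistedAffineE6 : Matrix (Fin 5) (Fin 5) ℤ :=
  !![ 2, -1,  0,  0,  0;
     -1,  2, -1,  0,  0;
      0, -1,  2, -2,  0;
      0,  0, -1,  2, -1;
      0,  0,  0, -1,  2]

/-- The affine matrix of type `E₈⁽¹⁾`. The diagram is the chain
`0 — 1 — 2 — 3 — 4 — 5 — 6 — 7` with a further vertex `8` joined to `5`. -/
def affineE8 : Matrix (Fin 9) (Fin 9) ℤ :=
  !![ 2, -1,  0,  0,  0,  0,  0,  0,  0;
     -1,  2, -1,  0,  0,  0,  0,  0,  0;
      0, -1,  2, -1,  0,  0,  0,  0,  0;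
      0,  0, -1,  2, -1,  0,  0,  0,  0;
      0,  0,  0, -1,  2, -1,  0,  0,  0;
      0,  0,  0,  0, -1,  2, -1,  0, -1;
      0,  0,  0,  0,  0, -1,  2, -1,  0;
      0,  0,  0,  0,  0,  0, -1,  2,  0;
      0,  0,  0,  0,  0, -1,  0,  0,  2]

/-- The concurrency relation `𝒞` on the vertices of a graph: `p 𝒞 q` if `p = q` or `p` and `q` are
adjacent. It is the complement of the relation "distinct and not adjacent". -/
def Concurrent {P : Type*} (Γ : SimpleGraph P) (p q : P) : Prop :=
  p = q ∨ Γ.Adj p q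

/-- A labelled heap over the graph `Γ`: a locally finite poset `E` with a labelling `ε : E → P` such
that elements with concurrent labels are comparable, and such that the order is the transitive
closure of its restriction to pairs with concurrent labels. -/
structure IsLabelledHeap {P E : Type*} [PartialOrder E] [LocallyFiniteOrder E]
    (Γ : SimpleGraph P) (ε : E → P) : Prop where
  comparable : ∀ α β, Concurrent Γ (ε α) (ε β) → α ≤ β ∨ β ≤ α
  le_iff_transGen : ∀ α β : E, α ≤ β ↔
    Relation.TransGen (fun γ δ => γ ≤ δ ∧ Concurrent Γ (ε γ) (ε δ)) α β

/-- A fibred heap over `Γ`. Each fibre `ε⁻¹(p)` is nonempty and unbounded above and below (so that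
it is a chain isomorphic to `ℤ`), and every element labelled `p` covers or is covered by an element
labelled `p'`, for each vertex `p'` adjacent to `p`. -/
structure IsFibredHeap {P E : Type*} [PartialOrder E] [LocallyFiniteOrder E]
    (Γ : SimpleGraph P) (ε : E → P) : Prop extends IsLabelledHeap Γ ε where
  nonempty_fibre : ∀ p, (ε ⁻¹' {p}).Nonempty
  not_bddAbove : ∀ p, ¬ BddAbove (ε ⁻¹' {p})
  not_bddBelow : ∀ p, ¬ BddBelow (ε ⁻¹' {p})
  exists_covers : ∀ p p', Γ.Adj p p' → ∀ α, ε α = p → ∃ β, ε β = p' ∧ (β ⋖ α ∨ α ⋖ β)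

/-- A full heap over the Dynkin diagram of `A`: a fibred heap in which every open interval `(α, β)`
between consecutive elements `α < β` with the same label `p` satisfies
`∑_{γ ∈ (α, β)} a_{p, ε(γ)} = -2`. -/
structure IsFullHeap {P E : Type*} [PartialOrder E] [LocallyFiniteOrder E]
    (A : Matrix P P ℤ) (ε : E → P) : Prop extends IsFibredHeap (dynkinGraph A) ε where
  sum_eq : ∀ (p : P) (α β : E), α < β → ε α = p → ε β = p →
    (∀ γ ∈ Finset.Ioo α β, ε γ ≠ p) → ∑ γ ∈ Finset.Ioo α β, A p (ε γ) = -2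

/-! Read a row of `A` along a full heap: each element labelled `p` contributes 2 to row `p`, each
gap between consecutive ones contributes -2, so the contributions telescope.

For finite type, let `c` count the labels in an interval. By telescoping, every entry of `A c` lies
between -2 and 2 (`abs_sum_Icc_le_two`), while the entries of `c` can be made arbitrarily large.
Multiplying by the adjugate bounds `det A * c p`, which forces `det A = 0` (`det_eq_zero`).

For the affine types, row `p` is a linear equation for the label counts in a gap over `p`. Near a
leaf these are rigid: if every gap over `q` contains a `p`, a gap over `p` contains at most one `q`
(`labelCount_le_one`), and this propagates along an arm (`gapsMeet_step`). At the double bond of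
`F₄⁽¹⁾` or `E₆⁽²⁾` the bound contradicts parity. For `E₈⁽¹⁾` it forces exactly three 5s between two
8s, where their number must be even. -/

open Finset

/-- Two consecutive elements of the fibre over `p`. -/
structure IsGap {P E : Type*} [PartialOrder E] (ε : E → P) (p : P) (α β : E) : Prop where
  lt : α < β
  left : ε α = p
  right : ε β = p
  label_ne : ∀ γ, α < γ → γ < β → ε γ ≠ p

/-- The properties of a full heap that do not involve covering relations or transitive closures.
They are invariant under relabelling. -/
structure IsWeakFullHeap {P E : Type*} [PartialOrder E] [LocallyFiniteOrder E]
    (A : Matrix P P ℤ) (ε : E → P) : Prop where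
  diag : ∀ p, A p p = 2
  comparable : ∀ α β, A (ε α) (ε β) ≠ 0 → α ≤ β ∨ β ≤ α
  nonempty_fibre : ∀ p, ∃ α, ε α = p
  exists_not_le : ∀ p γ, ∃ β, ε β = p ∧ ¬ β ≤ γ
  exists_not_ge : ∀ p γ, ∃ β, ε β = p ∧ ¬ γ ≤ β
  sum_eq : ∀ p α β, IsGap ε p α β → ∑ γ ∈ Ioo α β, A p (ε γ) = -2

theorem IsFullHeap.isWeakFullHeap {P E : Type*} [PartialOrder E] [LocallyFiniteOrder E]
    {A : Matrix P P ℤ} {ε : E → P} (hA : ∀ p, A p p = 2) (h : IsFullHeap A ε) :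
    IsWeakFullHeap A ε where
  diag := hA
  comparable α β hne := by
    apply h.comparable
    by_cases heq : ε α = ε β
    · exact Or.inl heq
    · exact Or.inr ⟨heq, Or.inl hne⟩
  nonempty_fibre p := h.nonempty_fibre p
  exists_not_le p γ := by
    by_contra! hc
    exact h.not_bddAbove p ⟨γ, fun β hβ => hc β hβ⟩
  exists_not_ge p γ := by
    by_contra! hc
    exact h.not_bddBelow p ⟨γ, fun β hβ => hc β hβ⟩
  sum_eq p α β hg := by
    refine h.sum_eq p α β hg.lt hg.left hg.right fun γ hγ => ?_
    rw [mem_Ioo] at hγ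
    exact hg.label_ne γ hγ.1 hγ.2

theorem IsWeakFullHeap.relabel {P Q E : Type*} [PartialOrder E] [LocallyFiniteOrder E]
    {A : Matrix P P ℤ} {B : Matrix Q Q ℤ} {ε : E → P} (h : IsWeakFullHeap A ε) (e : P ≃ Q)
    (he : ∀ p q, A p q = B (e p) (e q)) : IsWeakFullHeap B (e ∘ ε) where
  diag q := by simpa [he] using h.diag (e.symm q)
  comparable α β hne := h.comparable α β (by rwa [he])
  nonempty_fibre q := by
    obtain ⟨α, hα⟩ := h.nonempty_fibre (e.symm q)
    exact ⟨α, by simp [hα]⟩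
  exists_not_le q γ := by
    obtain ⟨α, hα, hn⟩ := h.exists_not_le (e.symm q) γ
    exact ⟨α, by simp [hα], hn⟩
  exists_not_ge q γ := by
    obtain ⟨α, hα, hn⟩ := h.exists_not_ge (e.symm q) γ
    exact ⟨α, by simp [hα], hn⟩
  sum_eq q α β hg := by
    have := h.sum_eq (e.symm q) α β ⟨hg.lt, by simpa [Equiv.eq_symm_apply] using hg.left,
      by simpa [Equiv.eq_symm_apply] using hg.right, fun γ h1 h2 => by
        simpa [Equiv.eq_symm_apply] using hg.label_ne γ h1 h2⟩
    simpa [he] using this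

/-- The number of elements labelled `q` in an open interval. -/
def labelCount {P E : Type*} [DecidableEq P] [PartialOrder E] [LocallyFiniteOrder E]
    (ε : E → P) (q : P) (α β : E) : ℕ :=
  #{γ ∈ Ioo α β | ε γ = q}

/-- Every gap of the fibre over `q` contains an element labelled `p`. -/
def GapsMeet {P E : Type*} [PartialOrder E] (ε : E → P) (q p : P) : Prop :=
  ∀ α β, IsGap ε q α β → ∃ γ, α < γ ∧ γ < β ∧ ε γ = p

/-! ### Neighbouring elements of a fibre -/

namespace IsWeakFullHeap

variable {P E : Type*} [PartialOrder E] [LocallyFiniteOrder E] {A : Matrix P P ℤ} {ε : E → P}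

theorem comparable_of_label_eq (h : IsWeakFullHeap A ε) {p : P} {α β : E} (hα : ε α = p)
    (hβ : ε β = p) : α ≤ β ∨ β ≤ α :=
  h.comparable α β (by rw [hα, hβ, h.diag]; norm_num)

theorem lt_or_lt (h : IsWeakFullHeap A ε) {α β : E} (hA : A (ε α) (ε β) ≠ 0) (hne : α ≠ β) :
    α < β ∨ β < α :=
  (h.comparable α β hA).imp (fun hle => lt_of_le_of_ne hle hne)
    fun hle => lt_of_le_of_ne hle hne.symm

/-- A nonzero entry makes all elements labelled `p` comparable with `γ`, so unboundedness puts one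
above `γ`. Local finiteness gives a minimal one, which is least because the fibre is a chain. -/
theorem exists_least_gt [DecidableEq P] (h : IsWeakFullHeap A ε) {p : P} {γ : E}
    (hA : A p (ε γ) ≠ 0) :
    ∃ β, ε β = p ∧ γ < β ∧ ∀ δ, ε δ = p → γ < δ → β ≤ δ := by
  obtain ⟨b, hb, hn⟩ := h.exists_not_le p γ
  have hlt : γ < b := by
    rcases h.comparable b γ (by rwa [hb]) with hle | hle
    · exact absurd hle hn
    · exact lt_of_le_not_ge hle hn
  obtain ⟨β, hβ⟩ := exists_minimal (s := {δ ∈ Ioc γ b | ε δ = p}) ⟨b, by simp [hb, hlt]⟩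
  have hm := hβ.prop
  simp only [mem_filter, mem_Ioc] at hm
  refine ⟨β, hm.2, hm.1.1, fun δ hδ hγδ => ?_⟩
  rcases h.comparable_of_label_eq hm.2 hδ with hle | hle
  · exact hle
  · exact hβ.le_of_le (by simp [hδ, hγδ, hle.trans hm.1.2]) hle

theorem exists_greatest_lt [DecidableEq P] (h : IsWeakFullHeap A ε) {p : P} {γ : E}
    (hA : A p (ε γ) ≠ 0) :
    ∃ β, ε β = p ∧ β < γ ∧ ∀ δ, ε δ = p → δ < γ → δ ≤ β := by
  obtain ⟨b, hb, hn⟩ := h.exists_not_ge p γ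
  have hlt : b < γ := by
    rcases h.comparable b γ (by rwa [hb]) with hle | hle
    · exact lt_of_le_not_ge hle hn
    · exact absurd hle hn
  obtain ⟨β, hβ⟩ := exists_maximal (s := {δ ∈ Ico b γ | ε δ = p}) ⟨b, by simp [hb, hlt]⟩
  have hm := hβ.prop
  simp only [mem_filter, mem_Ico] at hm
  refine ⟨β, hm.2, hm.1.2, fun δ hδ hγδ => ?_⟩
  rcases h.comparable_of_label_eq hδ hm.2 with hle | hle
  · exact hle
  · exact hβ.le_of_ge (by simp [hδ, hγδ, hm.1.1.trans hle]) hle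

theorem exists_gap_right [DecidableEq P] (h : IsWeakFullHeap A ε) {p : P} {α : E}
    (hα : ε α = p) : ∃ β, IsGap ε p α β ∧ ∀ δ, ε δ = p → α < δ → β ≤ δ := by
  obtain ⟨β, hβ, hlt, hmin⟩ := h.exists_least_gt (p := p) (γ := α)
    (by rw [hα, h.diag]; norm_num)
  exact ⟨β, ⟨hlt, hα, hβ, fun γ h1 h2 h3 => (hmin γ h3 h1).not_gt h2⟩, hmin⟩

theorem exists_gap_left [DecidableEq P] (h : IsWeakFullHeap A ε) {p : P} {β : E}
    (hβ : ε β = p) : ∃ α, IsGap ε p α β ∧ ∀ δ, ε δ = p → δ < β → δ ≤ α := by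
  obtain ⟨α, hα, hlt, hmax⟩ := h.exists_greatest_lt (p := p) (γ := β)
    (by rw [hβ, h.diag]; norm_num)
  exact ⟨α, ⟨hlt, hα, hβ, fun γ h1 h2 h3 => (hmax γ h3 h2).not_gt h1⟩, hmax⟩

/-- An element whose label is adjacent to `p` lies in a gap of the fibre over `p`. -/
theorem exists_gap_around [DecidableEq P] (h : IsWeakFullHeap A ε) {p : P} {γ : E}
    (hA : A p (ε γ) ≠ 0) (hne : ε γ ≠ p) : ∃ α β, IsGap ε p α β ∧ α < γ ∧ γ < β := by
  obtain ⟨β, hβ, hγβ, hmin⟩ := h.exists_least_gt hA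
  obtain ⟨α, hα, hαγ, hmax⟩ := h.exists_greatest_lt hA
  refine ⟨α, β, ⟨hαγ.trans hγβ, hα, hβ, fun δ h1 h2 h3 => ?_⟩, hαγ, hγβ⟩
  have hδ : δ ≠ γ := fun hc => hne (hc ▸ h3)
  rcases h.lt_or_lt (α := δ) (β := γ) (by rwa [h3]) hδ with hlt | hlt
  · exact (hmax δ h3 hlt).not_gt h1
  · exact (hmin δ h3 hlt).not_gt h2

/-! ### Matrices with nonzero determinant -/

/-- With `k` elements labelled `p` the sum is `2k - 2(k - 1)`. An element of the interval
incomparable to one of these has coefficient 0. The bound `n` serves the induction, which splits off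
the first gap. -/
theorem sum_Icc_eq_two [DecidableEq P] (h : IsWeakFullHeap A ε) {p : P} (n : ℕ) :
    ∀ α β : E, #(Icc α β) ≤ n → ε α = p → ε β = p → α ≤ β →
      ∑ γ ∈ Icc α β, A p (ε γ) = 2 := by
  classical
  induction n with
  | zero =>
    intro α β hc hα hβ hle
    have : α ∈ Icc α β := by simp [hle]
    simp only [nonpos_iff_eq_zero, card_eq_zero] at hc
    simp [hc] at this
  | succ n ih =>
    intro α β hc hα hβ hle
    rcases hle.eq_or_lt with rfl | hlt
    · simp [hα, h.diag]
    obtain ⟨α', hg, hmin⟩ := h.exists_gap_right hα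
    have hle' : α' ≤ β := hmin β hβ hlt
    have hsub : Icc α' β ⊂ Icc α β := by
      refine ⟨Icc_subset_Icc_left hg.lt.le, fun hc => ?_⟩
      have := hc (left_mem_Icc.2 hle)
      exact (mem_Icc.1 this).1.not_gt hg.lt
    have hrec := ih α' β (by have := card_lt_card hsub; omega) hg.right hβ hle'
    have hdisj : Disjoint (Ico α α') (Icc α' β) := by
      rw [Finset.disjoint_left]
      intro γ h1 h2
      exact (mem_Icc.1 h2).1.not_gt (mem_Ico.1 h1).2
    have hunion : Ico α α' ∪ Icc α' β ⊆ Icc α β := by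
      refine union_subset (fun γ hγ => ?_) hsub.1
      rw [mem_Ico] at hγ
      exact mem_Icc.2 ⟨hγ.1, hγ.2.le.trans hle'⟩
    rw [← sum_subset hunion, sum_union hdisj, hrec, ← Ioo_insert_left hg.lt,
      sum_insert (by simp), h.sum_eq p α α' hg, hα, h.diag]
    · norm_num
    · intro γ hγ hn
      by_contra hne
      rw [mem_Icc] at hγ
      simp only [mem_union, mem_Ico, mem_Icc, not_or, not_and] at hn
      rcases h.comparable α' γ (by rwa [hg.right]) with hc | hc
      · exact hn.2 hc hγ.2
      · rcases hc.eq_or_lt with rfl | hlt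
        · exact hn.2 le_rfl hγ.2
        · exact hn.1 hγ.1 hlt

/-- A set of elements in a gap over `p` has row sum between `-2` and `0`. -/
theorem sum_bounds_of_gap (h : IsWeakFullHeap A ε)
    (hA : ∀ p q, p ≠ q → A p q ≤ 0) {p : P} {α β : E} (hg : IsGap ε p α β) {s : Finset E}
    (hs : ∀ γ ∈ s, A p (ε γ) ≠ 0 → α < γ ∧ γ < β) :
    -2 ≤ ∑ γ ∈ s, A p (ε γ) ∧ ∑ γ ∈ s, A p (ε γ) ≤ 0 := by
  classical
  have hnp : ∀ γ ∈ Ioo α β, A p (ε γ) ≤ 0 := fun γ hγ => by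
    rw [mem_Ioo] at hγ
    exact hA _ _ (hg.label_ne γ hγ.1 hγ.2).symm
  have hsum : ∑ γ ∈ s with A p (ε γ) ≠ 0, A p (ε γ) = ∑ γ ∈ s, A p (ε γ) :=
    sum_filter_ne_zero s
  have hsub : {γ ∈ s | A p (ε γ) ≠ 0} ⊆ Ioo α β := fun γ hγ => by
    rw [mem_filter] at hγ
    exact mem_Ioo.2 (hs γ hγ.1 hγ.2)
  rw [← hsum]
  refine ⟨?_, sum_nonpos fun γ hγ => hnp γ (hsub hγ)⟩
  rw [← h.sum_eq p α β hg]
  have := sum_le_sum_of_subset_of_nonneg (f := fun γ => - A p (ε γ)) hsub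
    (fun γ hγ _ => by simpa using hnp γ hγ)
  simpa [sum_neg_distrib] using this

/-- The stretch from the first to the last `p` contributes 2, and the tails below and above it
contribute between -2 and 0 each. -/
theorem abs_sum_Icc_le_two [DecidableEq P] (h : IsWeakFullHeap A ε)
    (hA : ∀ p q, p ≠ q → A p q ≤ 0) (p : P) (α β : E) :
    |∑ γ ∈ Icc α β, A p (ε γ)| ≤ 2 := by
  classical
  by_cases hS : ∃ γ ∈ Icc α β, ε γ = p
  · have hne : ({γ ∈ Icc α β | ε γ = p} : Finset E).Nonempty := by
      obtain ⟨γ, h1, h2⟩ := hS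
      exact ⟨γ, by simpa [h2] using h1⟩
    obtain ⟨a, ha⟩ := exists_minimal hne
    obtain ⟨b, hb⟩ := exists_maximal hne
    have ha' := ha.prop
    have hb' := hb.prop
    simp only [mem_filter, mem_Icc] at ha' hb'
    have hab : a ≤ b := by
      rcases h.comparable_of_label_eq ha'.2 hb'.2 with hle | hle
      · exact hle
      · exact ha.le_of_le hb.prop hle
    obtain ⟨a₀, hga, -⟩ := h.exists_gap_left ha'.2
    obtain ⟨b₀, hgb, -⟩ := h.exists_gap_right hb'.2
    -- A contributing tail element is comparable with `a₀`. Were it at or below `a₀`, then `a₀`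
    -- would lie in the interval, against the minimality of `a`.
    have hlow := h.sum_bounds_of_gap hA hga (s := {γ ∈ Icc α β | γ < a}) (fun γ hγ hne => by
      simp only [mem_filter, mem_Icc] at hγ
      refine ⟨?_, hγ.2⟩
      rcases h.comparable a₀ γ (by rwa [hga.left]) with hle | hle
      · refine lt_of_le_of_ne hle ?_
        rintro rfl
        exact (ha.le_of_le (by simp [hγ.1, hga.left]) hga.lt.le).not_gt hga.lt
      · exact absurd hga.lt (ha.le_of_le (by
          simp [hga.left, hγ.1.1.trans hle, hga.lt.le.trans ha'.1.2]) hga.lt.le).not_gt)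
    have hup := h.sum_bounds_of_gap hA hgb (s := {γ ∈ Icc α β | b < γ}) (fun γ hγ hne => by
      simp only [mem_filter, mem_Icc] at hγ
      refine ⟨hγ.2, ?_⟩
      rcases h.comparable b₀ γ (by rwa [hgb.right]) with hle | hle
      · exact absurd hgb.lt (hb.le_of_ge (by
          simp [hgb.right, hle.trans hγ.1.2, hb'.1.1.trans hgb.lt.le]) hgb.lt.le).not_gt
      · refine lt_of_le_of_ne hle ?_
        rintro rfl
        exact (hb.le_of_ge (by simp [hγ.1, hgb.right]) hgb.lt.le).not_gt hgb.lt)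
    have hmid := h.sum_Icc_eq_two _ a b le_rfl ha'.2 hb'.2 hab
    have hd1 : Disjoint (Icc a b) {γ ∈ Icc α β | b < γ} := by
      rw [Finset.disjoint_left]
      intro γ h1 h2
      exact (mem_filter.1 h2).2.not_ge (mem_Icc.1 h1).2
    have hd2 : Disjoint ({γ ∈ Icc α β | γ < a} : Finset E)
        (Icc a b ∪ {γ ∈ Icc α β | b < γ}) := by
      rw [Finset.disjoint_left]
      intro γ h1 h2
      have h1' := (mem_filter.1 h1).2
      rcases mem_union.1 h2 with h2 | h2
      · exact (mem_Icc.1 h2).1.not_gt h1'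
      · exact (hab.trans_lt (mem_filter.1 h2).2).not_gt h1'
    have hsub : ({γ ∈ Icc α β | γ < a} : Finset E) ∪ (Icc a b ∪ {γ ∈ Icc α β | b < γ}) ⊆
        Icc α β :=
      union_subset (filter_subset _ _)
        (union_subset (Icc_subset_Icc ha'.1.1 hb'.1.2) (filter_subset _ _))
    rw [← sum_subset hsub, sum_union hd2, sum_union hd1, hmid, abs_le]
    · constructor <;> linarith [hlow.1, hlow.2, hup.1, hup.2]
    · intro γ hγ hn
      by_contra hne
      simp only [mem_union, mem_filter, mem_Icc, not_or, not_and] at hn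
      rw [mem_Icc] at hγ
      obtain ⟨n1, n2, n3⟩ := hn
      have hla : a ≤ γ := by
        rcases h.comparable a γ (by rwa [ha'.2]) with hle | hle
        · exact hle
        · exact (eq_of_le_of_not_lt hle (n1 hγ)).ge
      rcases h.comparable b γ (by rwa [hb'.2]) with hle | hle
      · exact n2 hla (eq_of_le_of_not_lt hle (n3 hγ)).ge
      · exact n2 hla hle
  -- Without a `p` in the interval, all contributing elements lie in one and the same gap over `p`.
  · push Not at hS
    by_cases hN : ∃ γ ∈ Icc α β, A p (ε γ) ≠ 0
    · obtain ⟨γ, hγ, hne⟩ := hN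
      obtain ⟨a, b, hg, haγ, hγb⟩ := h.exists_gap_around hne (hS γ hγ)
      rw [mem_Icc] at hγ
      have := h.sum_bounds_of_gap hA hg (s := Icc α β) (fun δ hδ hne' => by
        have hδp := hS δ hδ
        rw [mem_Icc] at hδ
        constructor
        · rcases h.lt_or_lt (α := a) (β := δ) (by rwa [hg.left])
            (fun hc => hδp (hc ▸ hg.left)) with hlt | hlt
          · exact hlt
          · exact absurd hg.left
              (hS a (mem_Icc.2 ⟨hδ.1.trans hlt.le, haγ.le.trans hγ.2⟩))
        · rcases h.lt_or_lt (α := b) (β := δ) (by rwa [hg.right])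
            (fun hc => hδp (hc ▸ hg.right)) with hlt | hlt
          · exact absurd hg.right
              (hS b (mem_Icc.2 ⟨hγ.1.trans hγb.le, hlt.le.trans hδ.2⟩))
          · exact hlt)
      rw [abs_le]
      constructor <;> linarith [this.1, this.2]
    · push Not at hN
      rw [sum_eq_zero hN]
      norm_num

theorem exists_card_fibre_ge [DecidableEq P] (h : IsWeakFullHeap A ε) {p : P} {α : E}
    (hα : ε α = p) (n : ℕ) :
    ∃ β, ε β = p ∧ α ≤ β ∧ n ≤ #{γ ∈ Icc α β | ε γ = p} := by
  induction n with
  | zero => exact ⟨α, hα, le_rfl, Nat.zero_le _⟩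
  | succ n ih =>
    obtain ⟨β, hβ, hle, hn⟩ := ih
    obtain ⟨β', hg, -⟩ := h.exists_gap_right hβ
    refine ⟨β', hg.right, hle.trans hg.lt.le, hn.trans_lt (card_lt_card ⟨?_, fun hc => ?_⟩)⟩
    · exact filter_subset_filter _ (Icc_subset_Icc_right hg.lt.le)
    · have := hc (mem_filter.2 ⟨mem_Icc.2 ⟨hle.trans hg.lt.le, le_rfl⟩, hg.right⟩)
      exact (mem_Icc.1 (mem_filter.1 this).1).2.not_gt hg.lt

theorem det_eq_zero [Fintype P] [DecidableEq P] [Nonempty P] (h : IsWeakFullHeap A ε)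
    (hA : ∀ p q, p ≠ q → A p q ≤ 0) : A.det = 0 := by
  by_contra hdet
  obtain ⟨p⟩ := ‹Nonempty P›
  obtain ⟨α, hα⟩ := h.nonempty_fibre p
  -- `M` bounds entry `p` of `adjugate A * (A c)`, as the entries of `A c` are at most 2 in absolute
  -- value. The interval is then chosen with more than `M` elements labelled `p`.
  set M : ℤ := ∑ q, |A.adjugate p q| * 2 with hM
  obtain ⟨β, -, -, hcard⟩ := h.exists_card_fibre_ge hα (M.toNat + 1)
  set c : P → ℤ := fun q => (#{γ ∈ Icc α β | ε γ = q} : ℤ) with hc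
  have hAc : ∀ q, A.mulVec c q = ∑ γ ∈ Icc α β, A q (ε γ) := fun q => by
    rw [← sum_fiberwise (Icc α β) ε]
    refine sum_congr rfl fun r _ => ?_
    rw [sum_congr rfl (g := fun _ => A q r) fun γ hγ => by rw [(mem_filter.1 hγ).2]]
    simp [hc, mul_comm]
  have hkey : A.adjugate.mulVec (A.mulVec c) p = A.det * c p := by
    simp [Matrix.mulVec_mulVec, Matrix.adjugate_mul]
  have hle : |A.det * c p| ≤ M := by
    rw [← hkey]
    refine (abs_sum_le_sum_abs _ _).trans (sum_le_sum fun q _ => ?_)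
    rw [abs_mul, hAc]
    exact mul_le_mul_of_nonneg_left (h.abs_sum_Icc_le_two hA q α β) (abs_nonneg _)
  have h1 : c p ≤ |A.det * c p| := by
    rw [abs_mul]
    have : 1 ≤ |A.det| := Int.one_le_abs hdet
    nlinarith [le_abs_self (c p), abs_nonneg (c p)]
  have h2 : ((M.toNat + 1 : ℕ) : ℤ) ≤ c p := by
    simp only [hc]
    exact_mod_cast hcard
  have := Int.self_le_toNat M
  push_cast at h2
  linarith

/-! ### Counting labels in gaps -/

variable [DecidableEq P]

theorem sum_mul_labelCount [Fintype P] (h : IsWeakFullHeap A ε) {p : P} {α β : E}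
    (hg : IsGap ε p α β) : ∑ q, A p q * (labelCount ε q α β : ℤ) = -2 := by
  rw [← h.sum_eq p α β hg, ← sum_fiberwise (Ioo α β) ε]
  refine sum_congr rfl fun r _ => ?_
  rw [sum_congr rfl (g := fun _ => A p r) fun γ hγ => by rw [(mem_filter.1 hγ).2]]
  simp [labelCount, mul_comm]

theorem labelCount_pos {q : P} {α β γ : E} (h1 : α < γ) (h2 : γ < β)
    (hγ : ε γ = q) : 1 ≤ labelCount ε q α β :=
  card_pos.2 ⟨γ, mem_filter.2 ⟨mem_Ioo.2 ⟨h1, h2⟩, hγ⟩⟩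

theorem labelCount_eq_zero {q : P} {α β : E} (h : ∀ γ, α < γ → γ < β → ε γ ≠ q) :
    labelCount ε q α β = 0 := by
  simpa [labelCount, filter_eq_empty_iff] using h

theorem labelCount_self {p : P} {α β : E} (hg : IsGap ε p α β) : labelCount ε p α β = 0 :=
  labelCount_eq_zero hg.label_ne

theorem exists_of_labelCount_pos {q : P} {α β : E} (h : 1 ≤ labelCount ε q α β) :
    ∃ γ, α < γ ∧ γ < β ∧ ε γ = q := by
  obtain ⟨γ, hγ⟩ := card_pos.1 h
  simp only [mem_filter, mem_Ioo] at hγ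
  exact ⟨γ, hγ.1.1, hγ.1.2, hγ.2⟩

theorem exists_of_labelCount_eq_two (h : IsWeakFullHeap A ε) {q : P} {α β : E}
    (hc : labelCount ε q α β = 2) : ∃ a b, α < a ∧ b < β ∧ IsGap ε q a b ∧
      ∀ t, α < t → t < β → ε t = q → t = a ∨ t = b := by
  classical
  obtain ⟨a, b, hab, hs⟩ := card_eq_two.1 hc
  wlog hlt : a < b generalizing a b
  · refine this b a hab.symm (by rw [hs, pair_comm]) ?_
    have ha : a ∈ ({γ ∈ Ioo α β | ε γ = q} : Finset E) := by simp [hs]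
    have hb : b ∈ ({γ ∈ Ioo α β | ε γ = q} : Finset E) := by simp [hs]
    exact ((h.comparable_of_label_eq (mem_filter.1 ha).2 (mem_filter.1 hb).2).resolve_left
      fun hle => hlt (lt_of_le_of_ne hle hab)).lt_of_ne hab.symm
  have hmem : ∀ t, (α < t ∧ t < β) ∧ ε t = q ↔ t = a ∨ t = b := fun t => by
    have : t ∈ ({γ ∈ Ioo α β | ε γ = q} : Finset E) ↔ t ∈ ({a, b} : Finset E) := by rw [hs]
    simpa using this
  have ha := (hmem a).2 (Or.inl rfl)
  have hb := (hmem b).2 (Or.inr rfl)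
  refine ⟨a, b, ha.1.1, hb.1.2, ⟨hlt, ha.2, hb.2, fun t h1 h2 h3 => ?_⟩,
    fun t h1 h2 h3 => (hmem t).1 ⟨⟨h1, h2⟩, h3⟩⟩
  rcases (hmem t).1 ⟨⟨ha.1.1.trans h1, h2.trans hb.1.2⟩, h3⟩ with rfl | rfl
  · exact h1.false
  · exact h2.false

/-- If all gaps over `q` contain a `p`, then a gap over `p` contains at most one `q`. -/
theorem labelCount_le_one (h : IsWeakFullHeap A ε) {p q : P} (hqp : GapsMeet ε q p) {α β : E}
    (hg : IsGap ε p α β) : labelCount ε q α β ≤ 1 := by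
  by_contra! hc
  obtain ⟨a, ha, b, hb, hab⟩ := one_lt_card.1 hc
  simp only [mem_filter, mem_Ioo] at ha hb
  wlog hlt : a < b generalizing a b
  · exact this b a hab.symm hb ha (((h.comparable_of_label_eq ha.2 hb.2).resolve_left
      fun hle => hlt (lt_of_le_of_ne hle hab)).lt_of_ne hab.symm)
  -- The gap over `q` starting at `a` ends at or before `b`, so its `p` would lie inside the gap
  -- over `p`.
  obtain ⟨b', hg', hmin⟩ := h.exists_gap_right ha.2
  obtain ⟨γ, h1, h2, h3⟩ := hqp a b' hg'
  exact hg.label_ne γ (ha.1.1.trans h1) ((h2.trans_le (hmin b hb.2 hlt)).trans hb.1.2) h3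

/-- If gaps over `r` contain a `q` and gaps over `q` without a `p` contain two `r`s, then all gaps
over `q` contain a `p`. -/
theorem gapsMeet_step (h : IsWeakFullHeap A ε) {p q r : P} (hrq : GapsMeet ε r q)
    (hrow : ∀ α β, IsGap ε q α β → labelCount ε p α β = 0 → 2 ≤ labelCount ε r α β) :
    GapsMeet ε q p := by
  intro α β hg
  by_contra! hc
  have h1 := h.labelCount_le_one hrq hg
  have h2 := hrow α β hg (labelCount_eq_zero hc)
  omega

theorem gapsMeet_of_labelCount {p q : P}
    (hrow : ∀ α β, IsGap ε q α β → labelCount ε p α β = 2) : GapsMeet ε q p := fun α β hg =>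
  exists_of_labelCount_pos (by rw [hrow α β hg]; norm_num)

end IsWeakFullHeap

/-! ### Parity at the double bond: types `F₄⁽¹⁾` and `E₆⁽²⁾` -/

open IsWeakFullHeap

theorem not_isWeakFullHeap_affineF4 {E : Type*} [PartialOrder E] [LocallyFiniteOrder E]
    (ε : E → Fin 5) : ¬ IsWeakFullHeap affineF4 ε := by
  intro h
  have row4 : ∀ α β, IsGap ε 4 α β → labelCount ε 3 α β = 2 := fun α β hg => by
    have := h.sum_mul_labelCount hg
    simp [affineF4, Fin.sum_univ_succ, labelCount_self hg] at this
    omega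
  have hmeet := gapsMeet_of_labelCount row4
  obtain ⟨γ, hγ⟩ := h.nonempty_fibre 4
  obtain ⟨α, β, hg, h1, h2⟩ := h.exists_gap_around (p := 3) (γ := γ)
    (by rw [hγ]; simp [affineF4]) (by rw [hγ]; decide)
  have hle := h.labelCount_le_one hmeet hg
  have hpos := labelCount_pos h1 h2 hγ
  -- Row 3 says that twice the number of 2s plus the number of 4s is 2, but there is exactly one 4.
  have := h.sum_mul_labelCount hg
  simp [affineF4, Fin.sum_univ_succ, labelCount_self hg] at this
  omega

theorem not_isWeakFullHeap_twistedAffineE6 {E : Type*} [PartialOrder E] [LocallyFiniteOrder E]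
    (ε : E → Fin 5) : ¬ IsWeakFullHeap twistedAffineE6 ε := by
  intro h
  have row0 : ∀ α β, IsGap ε 0 α β → labelCount ε 1 α β = 2 := fun α β hg => by
    have := h.sum_mul_labelCount hg
    simp [twistedAffineE6, Fin.sum_univ_succ, labelCount_self hg] at this
    omega
  have hmeet : GapsMeet ε 1 2 := h.gapsMeet_step (gapsMeet_of_labelCount row0)
    fun α β hg hc => by
      have := h.sum_mul_labelCount hg
      simp [twistedAffineE6, Fin.sum_univ_succ, labelCount_self hg, hc] at this
      omega
  obtain ⟨γ, hγ⟩ := h.nonempty_fibre 1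
  obtain ⟨α, β, hg, h1, h2⟩ := h.exists_gap_around (p := 2) (γ := γ)
    (by rw [hγ]; simp [twistedAffineE6]) (by rw [hγ]; decide)
  have hle := h.labelCount_le_one hmeet hg
  have hpos := labelCount_pos h1 h2 hγ
  -- Row 2 says that the number of 1s plus twice the number of 3s is 2, but there is exactly one 1.
  have := h.sum_mul_labelCount hg
  simp [twistedAffineE6, Fin.sum_univ_succ, labelCount_self hg] at this
  omega

/-! ### The branched diagram `E₈⁽¹⁾` -/

section AffineE8

variable {E : Type*} [PartialOrder E] [LocallyFiniteOrder E] {ε : E → Fin 9} {α β : E}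

theorem affineE8_row_zero (h : IsWeakFullHeap affineE8 ε) (hg : IsGap ε 0 α β) :
    labelCount ε 1 α β = 2 := by
  have := h.sum_mul_labelCount hg
  simp [affineE8, Fin.sum_univ_succ, labelCount_self hg] at this
  omega

theorem affineE8_row_one (h : IsWeakFullHeap affineE8 ε) (hg : IsGap ε 1 α β) :
    labelCount ε 0 α β + labelCount ε 2 α β = 2 := by
  have := h.sum_mul_labelCount hg
  simp [affineE8, Fin.sum_univ_succ, labelCount_self hg] at this
  omega

theorem affineE8_row_two (h : IsWeakFullHeap affineE8 ε) (hg : IsGap ε 2 α β) :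
    labelCount ε 1 α β + labelCount ε 3 α β = 2 := by
  have := h.sum_mul_labelCount hg
  simp [affineE8, Fin.sum_univ_succ, labelCount_self hg] at this
  omega

theorem affineE8_row_three (h : IsWeakFullHeap affineE8 ε) (hg : IsGap ε 3 α β) :
    labelCount ε 2 α β + labelCount ε 4 α β = 2 := by
  have := h.sum_mul_labelCount hg
  simp [affineE8, Fin.sum_univ_succ, labelCount_self hg] at this
  omega

theorem affineE8_row_four (h : IsWeakFullHeap affineE8 ε) (hg : IsGap ε 4 α β) :
    labelCount ε 3 α β + labelCount ε 5 α β = 2 := by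
  have := h.sum_mul_labelCount hg
  simp [affineE8, Fin.sum_univ_succ, labelCount_self hg] at this
  omega

theorem affineE8_row_five (h : IsWeakFullHeap affineE8 ε) (hg : IsGap ε 5 α β) :
    labelCount ε 4 α β + labelCount ε 6 α β + labelCount ε 8 α β = 2 := by
  have := h.sum_mul_labelCount hg
  simp [affineE8, Fin.sum_univ_succ, labelCount_self hg] at this
  omega

theorem affineE8_row_six (h : IsWeakFullHeap affineE8 ε) (hg : IsGap ε 6 α β) :
    labelCount ε 5 α β + labelCount ε 7 α β = 2 := by
  have := h.sum_mul_labelCount hg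
  simp [affineE8, Fin.sum_univ_succ, labelCount_self hg] at this
  omega

theorem affineE8_row_seven (h : IsWeakFullHeap affineE8 ε) (hg : IsGap ε 7 α β) :
    labelCount ε 6 α β = 2 := by
  have := h.sum_mul_labelCount hg
  simp [affineE8, Fin.sum_univ_succ, labelCount_self hg] at this
  omega

theorem affineE8_row_eight (h : IsWeakFullHeap affineE8 ε) (hg : IsGap ε 8 α β) :
    labelCount ε 5 α β = 2 := by
  have := h.sum_mul_labelCount hg
  simp [affineE8, Fin.sum_univ_succ, labelCount_self hg] at this
  omega

/-- Rigidity at the leaf 0 travels along the long arm to the branch vertex 5. -/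
theorem affineE8_gapsMeet_four_five (h : IsWeakFullHeap affineE8 ε) : GapsMeet ε 4 5 := by
  have h0 : GapsMeet ε 0 1 := gapsMeet_of_labelCount fun α β hg => affineE8_row_zero h hg
  have h1 : GapsMeet ε 1 2 := h.gapsMeet_step h0 fun α β hg hc => by
    have := affineE8_row_one h hg
    omega
  have h2 : GapsMeet ε 2 3 := h.gapsMeet_step h1 fun α β hg hc => by
    have := affineE8_row_two h hg
    omega
  have h3 : GapsMeet ε 3 4 := h.gapsMeet_step h2 fun α β hg hc => by
    have := affineE8_row_three h hg
    omega
  exact h.gapsMeet_step h3 fun α β hg hc => by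
    have := affineE8_row_four h hg
    omega

/-- A gap over `5` without a `6` contains an `8`. -/
theorem affineE8_exists_eight (h : IsWeakFullHeap affineE8 ε) (hg : IsGap ε 5 α β)
    (hc : ∀ γ, α < γ → γ < β → ε γ ≠ 6) : ∃ γ, α < γ ∧ γ < β ∧ ε γ = 8 := by
  have h1 := affineE8_row_five h hg
  have h2 := h.labelCount_le_one (affineE8_gapsMeet_four_five h) hg
  have h3 := labelCount_eq_zero hc
  exact exists_of_labelCount_pos (by omega)

/-- The number of `5`s between two `8`s is even, so it is not `3`. -/
theorem affineE8_labelCount_five_ne_three (h : IsWeakFullHeap affineE8 ε) {u u' : E}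
    (hu : ε u = 8) (hu' : ε u' = 8) : labelCount ε 5 u u' ≠ 3 := by
  classical
  intro hc
  have huu' : u < u' := by
    obtain ⟨γ, h1, h2, -⟩ := exists_of_labelCount_pos (hc.ge.trans' (by norm_num))
    exact h1.trans h2
  obtain ⟨v, hv, hmin⟩ := h.exists_gap_right hu
  have hvu' := hmin u' hu' huu'
  have h2 := affineE8_row_eight h hv
  -- One gap over 8 gives two 5s; two gaps already give at least four.
  rcases hvu'.eq_or_lt with rfl | hlt
  · omega
  obtain ⟨w, hw, hmin'⟩ := h.exists_gap_right hv.right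
  have hwu' := hmin' u' hu' hlt
  have h3 := affineE8_row_eight h hw
  have hd : Disjoint ({γ ∈ Ioo u v | ε γ = 5} : Finset E) {γ ∈ Ioo v w | ε γ = 5} := by
    rw [Finset.disjoint_left]
    intro γ m1 m2
    simp only [mem_filter, mem_Ioo] at m1 m2
    exact m1.1.2.not_gt m2.1.1
  have hsub : ({γ ∈ Ioo u v | ε γ = 5} ∪ {γ ∈ Ioo v w | ε γ = 5} : Finset E) ⊆
      ({γ ∈ Ioo u u' | ε γ = 5} : Finset E) :=
    union_subset (filter_subset_filter _ (Ioo_subset_Ioo_right hvu'))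
      (filter_subset_filter _ (Ioo_subset_Ioo hv.lt.le hwu'))
  have := card_le_card hsub
  rw [card_union_of_disjoint hd] at this
  unfold labelCount at *
  omega

/-- Around three consecutive 7s `w₀ < w₁ < w₂` the heap contains `w₀ < s₁ < x < u < y < s₂ < z < s₃
< x' < u' < y' < s₄ < w₂`, with the `s` labelled 6, `x, y, z, x', y'` labelled 5, and `u, u'`
labelled 8; `w₁` lies between `s₂` and `s₃`. The 5s between `u` and `u'` are then `y, z, x'`. -/
theorem not_isWeakFullHeap_affineE8 : ¬ IsWeakFullHeap affineE8 ε := by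
  classical
  intro h
  have c65 : ∀ a b : E, ε a = 6 → ε b = 5 → a < b ∨ b < a := fun a b ha hb =>
    h.lt_or_lt (by rw [ha, hb]; simp [affineE8]) (by rintro rfl; simp [ha] at hb)
  have c67 : ∀ a b : E, ε a = 6 → ε b = 7 → a < b ∨ b < a := fun a b ha hb =>
    h.lt_or_lt (by rw [ha, hb]; simp [affineE8]) (by rintro rfl; simp [ha] at hb)
  obtain ⟨w₀, hw₀⟩ := h.nonempty_fibre 7
  obtain ⟨w₁, hw₀₁, -⟩ := h.exists_gap_right hw₀
  obtain ⟨w₂, hw₁₂, -⟩ := h.exists_gap_right hw₀₁.right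
  obtain ⟨s₁, s₂, hws, hsw, hs, hs_only⟩ :=
    h.exists_of_labelCount_eq_two (affineE8_row_seven h hw₀₁)
  obtain ⟨s₃, s₄, hws', hsw', hs', hs'_only⟩ :=
    h.exists_of_labelCount_eq_two (affineE8_row_seven h hw₁₂)
  have hmid : IsGap ε 6 s₂ s₃ := ⟨hsw.trans hws', hs.right, hs'.left, fun t h1 h2 h3 => by
    rcases c67 t w₁ h3 hw₁₂.left with hlt | hlt
    · rcases hs_only t ((hws.trans hs.lt).trans h1) hlt h3 with rfl | rfl
      · exact h1.not_gt hs.lt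
      · exact h1.false
    · rcases hs'_only t hlt (h2.trans (hs'.lt.trans hsw')) h3 with rfl | rfl
      · exact h2.false
      · exact h2.not_gt hs'.lt⟩
  have five_two : ∀ {a b w w' : E}, IsGap ε 6 a b → IsGap ε 7 w w' → w < a → b < w' →
      labelCount ε 5 a b = 2 := fun {a b w w'} hg hw h1 h2 => by
    have e1 := affineE8_row_six h hg
    have e2 : labelCount ε 7 a b = 0 := labelCount_eq_zero fun γ g1 g2 =>
      hw.label_ne γ (h1.trans g1) (g2.trans h2)
    omega
  have h67 : GapsMeet ε 7 6 := gapsMeet_of_labelCount fun α β hg => affineE8_row_seven h hg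
  -- The gap contains `w₁` and no second 7, so row 6 leaves room for a single 5.
  have hz : labelCount ε 5 s₂ s₃ = 1 := by
    have e1 := affineE8_row_six h hmid
    have e2 := h.labelCount_le_one h67 hmid
    have e3 := labelCount_pos hsw hws' hw₁₂.left
    omega
  obtain ⟨x, y, hsx, hys, hxy, hxy_only⟩ :=
    h.exists_of_labelCount_eq_two (five_two hs hw₀₁ hws hsw)
  obtain ⟨x', y', hsx', hys', hxy', hxy'_only⟩ :=
    h.exists_of_labelCount_eq_two (five_two hs' hw₁₂ hws' hsw')
  obtain ⟨z, hz_only⟩ := card_eq_one.1 hz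
  have hzmem : ∀ t, (s₂ < t ∧ t < s₃) ∧ ε t = 5 ↔ t = z := fun t => by
    have : t ∈ ({γ ∈ Ioo s₂ s₃ | ε γ = 5} : Finset E) ↔ t ∈ ({z} : Finset E) := by rw [hz_only]
    simpa using this
  obtain ⟨⟨hsz, hzs⟩, hz5⟩ := (hzmem z).2 rfl
  obtain ⟨u, hxu, huy, hu⟩ := affineE8_exists_eight h hxy fun γ h1 h2 =>
    hs.label_ne γ (hsx.trans h1) (h2.trans hys)
  obtain ⟨u', hxu', huy', hu'⟩ := affineE8_exists_eight h hxy' fun γ h1 h2 =>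
    hs'.label_ne γ (hsx'.trans h1) (h2.trans hys')
  have hyz : y < z := hys.trans hsz
  have hzx' : z < x' := hzs.trans hsx'
  refine affineE8_labelCount_five_ne_three h hu hu' ?_
  have heq : ({γ ∈ Ioo u u' | ε γ = 5} : Finset E) = {y, z, x'} := by
    ext t
    simp only [mem_filter, mem_Ioo, mem_insert, mem_singleton]
    constructor
    · rintro ⟨⟨h1, h2⟩, h3⟩
      -- Comparison with `s₂` and `s₃` puts `t` in one of the three gaps over 6, whose 5s are known.
      rcases c65 s₂ t hs.right h3 with hlt | hlt
      · rcases c65 s₃ t hs'.left h3 with hlt' | hlt'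
        · rcases hxy'_only t hlt' ((h2.trans huy').trans hys') h3 with rfl | rfl
          · exact Or.inr (Or.inr rfl)
          · exact absurd h2 huy'.not_gt
        · exact Or.inr (Or.inl ((hzmem t).1 ⟨⟨hlt, hlt'⟩, h3⟩))
      · rcases hxy_only t ((hsx.trans hxu).trans h1) hlt h3 with rfl | rfl
        · exact absurd h1 hxu.not_gt
        · exact Or.inl rfl
    · rintro (rfl | rfl | rfl)
      · exact ⟨⟨huy, (hyz.trans hzx').trans hxu'⟩, hxy.right⟩
      · exact ⟨⟨huy.trans hyz, hzx'.trans hxu'⟩, hz5⟩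
      · exact ⟨⟨(huy.trans hyz).trans hzx', hxu'⟩, hxy'.left⟩
  rw [labelCount, heq, card_eq_three]
  exact ⟨y, z, x', hyz.ne, (hyz.trans hzx').ne, hzx'.ne, rfl⟩

end AffineE8

/-! ### Transport along relabellings and conclusion -/

theorem SameType.diag {P Q : Type*} {A : Matrix P P ℤ} {B : Matrix Q Q ℤ} (h : SameType A B)
    (hB : ∀ q, B q q = 2) (p : P) : A p p = 2 := by
  obtain ⟨e, he⟩ := h
  rw [he, hB]

theorem SameType.exists_isWeakFullHeap {P Q E : Type*} [PartialOrder E] [LocallyFiniteOrder E]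
    {A : Matrix P P ℤ} {B : Matrix Q Q ℤ} {ε : E → P} (h : SameType A B)
    (hB : ∀ q, B q q = 2) (hε : IsFullHeap A ε) : ∃ ε' : E → Q, IsWeakFullHeap B ε' := by
  have hw := hε.isWeakFullHeap (h.diag hB)
  obtain ⟨e, he⟩ := h
  exact ⟨e ∘ ε, hw.relabel e he⟩

theorem corollary8p8 {P : Type*} [Fintype P] [DecidableEq P] (A : Matrix P P ℤ)
    (hA : IsFiniteTypeGCM A ∨ SameType A affineF4 ∨ SameType A affineE8 ∨
      SameType A twistedAffineE6)
    {E : Type*} [PartialOrder E] [LocallyFiniteOrder E] (ε : E → P) :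
    ¬ IsFullHeap A ε := by
  intro h
  rcases hA with hA | hA | hA | hA
  · have := hA.connected.nonempty
    exact hA.det_ne_zero
      ((h.isWeakFullHeap hA.isGCM.diag).det_eq_zero hA.isGCM.nonpos)
  · obtain ⟨ε', h'⟩ := hA.exists_isWeakFullHeap (by decide) h
    exact not_isWeakFullHeap_affineF4 ε' h'
  · obtain ⟨ε', h'⟩ := hA.exists_isWeakFullHeap (by decide) h
    exact not_isWeakFullHeap_affineE8 h'
  · obtain ⟨ε', h'⟩ := hA.exists_isWeakFullHeap (by decide) h
    exact not_isWeakFullHeap_twistedAffineE6 ε' h'
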